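/- For $n\ge 3$ let $T_n=K_{1,1,n-2}$ be the complete tripartite graph with parts of sizes $1,1,n-2$, i.e. $n-2$ triangles sharing a common edge (the base); the two ends of the base are the base vertices, and the $n-2$ vertices of the third part are the non-base vertices. For $n\ge 3$, $n\ne 6$ and $b\ge 1$ let $T_6\circledcirc T_n^{(b)}$ be the graph obtained from one copy of $T_6$ and $b$ copies of $T_n$ by choosing a non-base vertex in each copy and identifying all the chosen vertices to a single (central cut) vertex; its blocks are one $T_6$ and $b$ copies of $T_n$, and it is unique up to isomorphism. Let $D$ be its distance matrix, whose $(u,v)$ entry is the length of a shortest path between the vertices $u$ and $v$. Then $$\det D\bigl(T_6\circledcirc T_n^{(b)}\bigr)=(-1)^{nb+1}\,2^{(n-3)b+4}\,(n-6)^b .$$ -/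

import Mathlib

/-- The distance matrix `D(G)` of a graph `G`: its `(u, v)` entry is the length of a shortest path
from `u` to `v`. -/
noncomputable def distMatrix {V : Type*} (G : SimpleGraph V) : Matrix V V ℝ :=
  Matrix.of fun u v => (G.dist u v : ℝ)

/-- Vertices of `T_n = K_{1,1,n-2}` (`n ≥ 3`): the parts `0` and `1` consist of one (base) vertex
each, and the part `2` consists of the `n - 2` non-base vertices. -/
abbrev TVert (n : ℕ) : Type := Σ i : Fin 3, Fin (![1, 1, n - 2] i)

/-- The complete tripartite graph `T_n = K_{1,1,n-2}`, i.e. `n - 2` triangles with a common base. -/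
def TGraph (n : ℕ) : SimpleGraph (TVert n) :=
  SimpleGraph.completeMultipartiteGraph fun i : Fin 3 => Fin (![1, 1, n - 2] i)

/-- A non-base vertex of `T_n`; any two of them are exchanged by an automorphism of `T_n`. -/
def TApex (n : ℕ) (hn : 3 ≤ n) : TVert n :=
  ⟨2, ⟨0, Nat.sub_pos_of_lt hn⟩⟩

/-- Vertices of the graph obtained from a disjoint union by identifying all the vertices `r i`:
`none` is the common vertex. -/
abbrev GluedVert {ι : Type*} {V : ι → Type*} (r : ∀ i, V i) : Type _ :=
  Option (Σ i, {v : V i // v ≠ r i})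

open Classical in
/-- The map from the vertices of the `i`-th graph to those of the glued graph. -/
noncomputable def gluedIncl {ι : Type*} {V : ι → Type*} (r : ∀ i, V i) (i : ι) (v : V i) :
    GluedVert r :=
  if h : v = r i then none else some ⟨i, v, h⟩

theorem gluedIncl_injective {ι : Type*} {V : ι → Type*} (r : ∀ i, V i) (i : ι) :
    Function.Injective (gluedIncl r i) := by
  intro u v h
  unfold gluedIncl at h
  split_ifs at h with hu hv hv
  · rw [hu, hv]
  · simpa using h

/-- The one-point union of the graphs `H i`: the disjoint union of all of them, with the vertices
`r i` identified to a single vertex. -/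
def gluedGraph {ι : Type*} {V : ι → Type*} (H : ∀ i, SimpleGraph (V i)) (r : ∀ i, V i) :
    SimpleGraph (GluedVert r) where
  Adj x y := ∃ (i : ι) (u v : V i), (H i).Adj u v ∧ gluedIncl r i u = x ∧ gluedIncl r i v = y
  symm := ⟨by
    rintro x y ⟨i, u, v, h, hx, hy⟩
    exact ⟨i, v, u, h.symm, hy, hx⟩⟩
  loopless := ⟨by
    rintro x ⟨i, u, v, h, hx, hy⟩
    exact h.ne (gluedIncl_injective r i (hx.trans hy.symm))⟩

/-- Orders of the blocks: one block `T_6` (index `none`) and `b` blocks `T_n`. -/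
def blockOrder (n b : ℕ) (i : Option (Fin b)) : ℕ :=
  i.elim 6 fun _ => n

theorem three_le_blockOrder {n : ℕ} (hn : 3 ≤ n) (b : ℕ) (i : Option (Fin b)) :
    3 ≤ blockOrder n b i := by
  cases i with
  | none => exact (by norm_num : 3 ≤ 6)
  | some j => exact hn

/-- The central vertex as seen in each block: a non-base vertex. -/
def blockCentre {n : ℕ} (hn : 3 ≤ n) (b : ℕ) (i : Option (Fin b)) : TVert (blockOrder n b i) :=
  TApex (blockOrder n b i) (three_le_blockOrder hn b i)

/-- The graph `T_6 ⊚ T_n^{(b)}`: one copy of `T_6` and `b` copies of `T_n`, glued at one central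
vertex, which is a non-base vertex of every block. -/
def T6Tn {n : ℕ} (hn : 3 ≤ n) (b : ℕ) : SimpleGraph (GluedVert (blockCentre hn b)) :=
  gluedGraph (fun i => TGraph (blockOrder n b i)) (blockCentre hn b)

/-! Distances between different blocks add through the centre `o`. Subtracting d(x, o) + d(y, o)
from the distance matrix on the vertices outside T_6 therefore leaves a block diagonal matrix, with
one block for each copy of T_n. The subtraction comes for free from T_6: its distance matrix A has a
vector w with zero entry sum and A w constant equal to 2, so multiples of w and the column of A at
`o` clear the whole border (`det_fromBlocks_of_border`). The determinant is thus det A = -16 times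
the product of b equal determinants, evaluated by `det_coneMatrix`. With m = n - 3 each of these is
(-1)^n 2^(n-3) (n - 6). -/

/-- The source of all lower bounds on distances in the glued graph; `d` will be pulled back along
retractions onto the blocks. -/
theorem SimpleGraph.Walk.le_length_of_adj_le_one {W : Type*} {G : SimpleGraph W} (d : W → W → ℕ)
    (hself : ∀ x, d x x = 0) (htri : ∀ x y z, d x z ≤ d x y + d y z)
    (hadj : ∀ x y, G.Adj x y → d x y ≤ 1) {x y : W} (p : G.Walk x y) : d x y ≤ p.length := by
  induction p with
  | nil => simp [hself]
  | cons h p ih =>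
    refine (htri _ _ _).trans ((add_le_add (hadj _ _ h) ih).trans ?_)
    simp [add_comm]

theorem SimpleGraph.Iso.dist_eq {V W : Type*} {G : SimpleGraph V} {H : SimpleGraph W} (e : G ≃g H)
    (hG : G.Connected) (u v : V) : H.dist (e u) (e v) = G.dist u v := by
  have hH : H.Connected := e.connected_iff.mp hG
  apply le_antisymm
  · obtain ⟨p, hp⟩ := hG.exists_walk_length_eq_dist u v
    rw [← hp, ← p.length_map e.toHom]
    exact SimpleGraph.dist_le _
  · obtain ⟨p, hp⟩ := hH.exists_walk_length_eq_dist (e u) (e v)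
    rw [← hp, ← p.length_map e.symm.toHom]
    have h := SimpleGraph.dist_le (p.map e.symm.toHom)
    simpa using h

/-! ### Distances in a one-point union. -/

section Glued

variable {ι : Type*} {V : ι → Type*} {H : ∀ i, SimpleGraph (V i)} {r : ∀ i, V i}

@[simp]
theorem gluedIncl_root (i : ι) : gluedIncl r i (r i) = none := by
  simp [gluedIncl]

theorem gluedIncl_of_ne (i : ι) {v : V i} (h : v ≠ r i) : gluedIncl r i v = some ⟨i, v, h⟩ := by
  simp [gluedIncl, h]

open Classical in
/-- The retraction of the one-point union onto the `i`-th graph, which sends all other graphs to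
the root. -/
noncomputable def gluedProj (r : ∀ i, V i) (i : ι) : GluedVert r → V i
  | none => r i
  | some ⟨j, v⟩ => if h : j = i then h ▸ v.1 else r i

theorem gluedProj_incl (i : ι) (v : V i) : gluedProj r i (gluedIncl r i v) = v := by
  by_cases h : v = r i
  · subst h; simp [gluedProj]
  · simp [gluedIncl_of_ne i h, gluedProj]

theorem gluedProj_incl_of_ne {i j : ι} (hij : j ≠ i) (v : V j) :
    gluedProj r i (gluedIncl r j v) = r i := by
  by_cases h : v = r j
  · subst h; simp [gluedProj]
  · simp [gluedIncl_of_ne j h, gluedProj, hij]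

/-- The inclusion of the `i`-th graph in the one-point union. -/
noncomputable def gluedHom (H : ∀ i, SimpleGraph (V i)) (r : ∀ i, V i) (i : ι) :
    H i →g gluedGraph H r where
  toFun := gluedIncl r i
  map_rel' {u v} h := ⟨i, u, v, h, rfl, rfl⟩

theorem dist_gluedProj_le_of_adj (i : ι) {x y : GluedVert r} (h : (gluedGraph H r).Adj x y) :
    (H i).dist (gluedProj r i x) (gluedProj r i y) ≤ 1 := by
  obtain ⟨j, u, v, huv, rfl, rfl⟩ := h
  by_cases hj : j = i
  · subst hj
    rw [gluedProj_incl, gluedProj_incl, SimpleGraph.dist_eq_one_iff_adj.mpr huv]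
  · simp [gluedProj_incl_of_ne hj]

/-- An edge lies in a single graph, so at least one of the two retractions collapses it to the root.
-/
theorem dist_gluedProj_add_le_of_adj {i j : ι} (hij : i ≠ j) {x y : GluedVert r}
    (h : (gluedGraph H r).Adj x y) :
    (H i).dist (gluedProj r i x) (gluedProj r i y) +
      (H j).dist (gluedProj r j x) (gluedProj r j y) ≤ 1 := by
  have hi := dist_gluedProj_le_of_adj i h
  have hj := dist_gluedProj_le_of_adj j h
  obtain ⟨k, u, v, huv, rfl, rfl⟩ := h
  by_cases hk : k = i
  · have hkj : k ≠ j := hk ▸ hij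
    simpa [gluedProj_incl_of_ne hkj] using hi
  · simpa [gluedProj_incl_of_ne hk] using hj

theorem eq_root_of_gluedIncl_eq {i j : ι} (hij : i ≠ j) {u : V i} {v : V j}
    (h : gluedIncl r i u = gluedIncl r j v) : v = r j := by
  rw [← gluedProj_incl (r := r) j v, ← h, gluedProj_incl_of_ne hij]

theorem gluedIncl_surjective (x : GluedVert r) [Nonempty ι] : ∃ i v, gluedIncl r i v = x := by
  rcases x with _ | ⟨i, v, hv⟩
  · exact ⟨Classical.arbitrary ι, _, gluedIncl_root _⟩
  · exact ⟨i, v, gluedIncl_of_ne i hv⟩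

theorem gluedGraph_connected [Nonempty ι] (hH : ∀ i, (H i).Connected) :
    (gluedGraph H r).Connected := by
  have key : ∀ x, (gluedGraph H r).Reachable x none := fun x ↦ by
    obtain ⟨i, v, rfl⟩ := gluedIncl_surjective x
    have h : (gluedGraph H r).Reachable (gluedIncl r i v) (gluedIncl r i (r i)) :=
      ((hH i).preconnected v (r i)).map (gluedHom H r i)
    rwa [gluedIncl_root] at h
  have : Nonempty (GluedVert r) := ⟨none⟩
  exact ⟨fun x y ↦ (key x).trans (key y).symm⟩

theorem gluedGraph_dist_incl_le (hH : ∀ i, (H i).Connected) (i : ι) (u v : V i) :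
    (gluedGraph H r).dist (gluedIncl r i u) (gluedIncl r i v) ≤ (H i).dist u v := by
  obtain ⟨p, hp⟩ := (hH i).exists_walk_length_eq_dist u v
  rw [← hp, ← p.length_map (gluedHom H r i)]
  exact SimpleGraph.dist_le _

/-- The inclusion does not increase distances, and neither does its left inverse, the retraction. -/
theorem gluedGraph_dist_incl (hH : ∀ i, (H i).Connected) (i : ι) (u v : V i) :
    (gluedGraph H r).dist (gluedIncl r i u) (gluedIncl r i v) = (H i).dist u v := by
  apply (gluedGraph_dist_incl_le hH i u v).antisymm
  have : Nonempty ι := ⟨i⟩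
  obtain ⟨p, hp⟩ := (gluedGraph_connected hH).exists_walk_length_eq_dist
    (gluedIncl r i u) (gluedIncl r i v)
  have h := p.le_length_of_adj_le_one (fun x y ↦ (H i).dist (gluedProj r i x) (gluedProj r i y))
    (fun _ ↦ by simp) (fun _ _ _ ↦ (hH i).dist_triangle)
    (fun _ _ h ↦ dist_gluedProj_le_of_adj i h)
  simpa [hp, gluedProj_incl] using h

/-- The upper bound goes through the root. For the lower bound, the sum of the two retracted
distances grows by at most 1 per edge. -/
theorem gluedGraph_dist_incl_of_ne (hH : ∀ i, (H i).Connected) {i j : ι} (hij : i ≠ j)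
    (u : V i) (v : V j) :
    (gluedGraph H r).dist (gluedIncl r i u) (gluedIncl r j v) =
      (H i).dist u (r i) + (H j).dist v (r j) := by
  have : Nonempty ι := ⟨i⟩
  have hc := gluedGraph_connected (r := r) hH
  apply le_antisymm
  · have hi := gluedGraph_dist_incl_le (r := r) hH i u (r i)
    have hj := gluedGraph_dist_incl_le (r := r) hH j v (r j)
    rw [gluedIncl_root] at hi hj
    rw [SimpleGraph.dist_comm] at hj
    exact hc.dist_triangle.trans (add_le_add hi hj)
  · obtain ⟨p, hp⟩ := hc.exists_walk_length_eq_dist (gluedIncl r i u) (gluedIncl r j v)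
    have h := p.le_length_of_adj_le_one
      (fun x y ↦ (H i).dist (gluedProj r i x) (gluedProj r i y) +
        (H j).dist (gluedProj r j x) (gluedProj r j y))
      (fun _ ↦ by simp)
      (fun x y z ↦ (add_le_add ((hH i).dist_triangle (v := gluedProj r i y))
        ((hH j).dist_triangle (v := gluedProj r j y))).trans (by omega))
      (fun _ _ h ↦ dist_gluedProj_add_le_of_adj hij h)
    rw [hp, gluedProj_incl, gluedProj_incl, gluedProj_incl_of_ne hij, gluedProj_incl_of_ne hij.symm,
      (H j).dist_comm] at h
    exact h

end Glued

/-! ### Distances in T_n. -/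

theorem TGraph_adj_iff {n : ℕ} {u v : TVert n} : (TGraph n).Adj u v ↔ u.1 ≠ v.1 := by
  simp [TGraph]

theorem TVert.fst_ne_zero_of_ne {n : ℕ} {u v : TVert n} (hne : u ≠ v) (h : u.1 = v.1) :
    u.1 ≠ 0 := by
  rintro h0
  obtain ⟨i, x⟩ := u
  obtain ⟨j, y⟩ := v
  obtain rfl : i = j := h
  obtain rfl : i = 0 := h0
  exact hne (congrArg _ (Subsingleton.elim (α := Fin 1) x y))

theorem TGraph_exists_adj_adj {n : ℕ} {u v : TVert n} (hne : u ≠ v) (h : u.1 = v.1) :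
    ∃ w, (TGraph n).Adj u w ∧ (TGraph n).Adj w v := by
  have h0 := TVert.fst_ne_zero_of_ne hne h
  exact ⟨⟨0, (0 : Fin 1)⟩, TGraph_adj_iff.mpr h0, TGraph_adj_iff.mpr (h ▸ h0.symm)⟩

theorem TGraph_connected (n : ℕ) : (TGraph n).Connected := by
  have : Nonempty (TVert n) := ⟨⟨0, (0 : Fin 1)⟩⟩
  refine ⟨fun u v ↦ ?_⟩
  by_cases hne : u = v
  · exact hne ▸ SimpleGraph.Reachable.refl _
  by_cases h : u.1 = v.1
  · obtain ⟨w, h1, h2⟩ := TGraph_exists_adj_adj hne h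
    exact h1.reachable.trans h2.reachable
  · exact (TGraph_adj_iff.mpr h).reachable

theorem TGraph_dist {n : ℕ} (u v : TVert n) :
    (TGraph n).dist u v = if u = v then 0 else if u.1 = v.1 then 2 else 1 := by
  split_ifs with hne h
  · simp [hne]
  · obtain ⟨w, h1, h2⟩ := TGraph_exists_adj_adj hne h
    refine le_antisymm (SimpleGraph.dist_le (.cons h1 (.cons h2 .nil))) ?_
    exact (TGraph_connected n).one_lt_dist_of_ne_of_not_adj hne (by simpa [TGraph_adj_iff] using h)
  · exact SimpleGraph.dist_eq_one_iff_adj.mpr (TGraph_adj_iff.mpr h)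

/-! ### Determinants of structured and bordered matrices. -/

theorem Matrix.det_scalar_add_const {m : Type*} [Fintype m] [DecidableEq m] {s : ℝ} (hs : s ≠ 0)
    (x : ℝ) : (s • (1 : Matrix m m ℝ) + Matrix.of fun _ _ ↦ x).det =
      s ^ Fintype.card m * (1 + Fintype.card m * x / s) := by
  have h : s • (1 : Matrix m m ℝ) + Matrix.of (fun _ _ ↦ x) =
      s • (1 + Matrix.replicateCol Unit (fun _ : m ↦ x / s) *
        Matrix.replicateRow Unit (fun _ : m ↦ (1 : ℝ))) := by
    ext i j
    simp [Matrix.mul_apply]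
    field_simp
  rw [h, Matrix.det_smul, Matrix.det_one_add_replicateCol_mul_replicateRow]
  simp [dotProduct, mul_div_assoc]

/-- The symmetric matrix on `Fin 2 ⊕ m` with diagonal blocks `!![p, q; q, p]` and `s I + t J`, and
with all other entries equal to `c`. -/
def coneMatrix (m : Type*) [DecidableEq m] (p q c s t : ℝ) : Matrix (Fin 2 ⊕ m) (Fin 2 ⊕ m) ℝ :=
  Matrix.fromBlocks !![p, q; q, p] (Matrix.of fun _ _ ↦ c) (Matrix.of fun _ _ ↦ c)
    (s • (1 : Matrix m m ℝ) + Matrix.of fun _ _ ↦ t)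

theorem det_coneMatrix {m : Type*} [Fintype m] [DecidableEq m] {p q s : ℝ} (c t : ℝ)
    (hpq : p + q ≠ 0) (hpq' : p - q ≠ 0) (hs : s ≠ 0) :
    (coneMatrix m p q c s t).det = (p + q) * (p - q) *
      (s ^ Fintype.card m * (1 + Fintype.card m * (t - 2 * c ^ 2 / (p + q)) / s)) := by
  let P : Matrix (Fin 2) (Fin 2) ℝ := !![p, q; q, p]
  let Q : Matrix (Fin 2) (Fin 2) ℝ := ((p + q) * (p - q))⁻¹ • !![p, -q; -q, p]
  have hPQ : P * Q = 1 := by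
    ext i j
    fin_cases i <;> fin_cases j <;> simp [P, Q, Matrix.mul_apply, Fin.sum_univ_two] <;>
      field_simp <;> ring
  let : Invertible P := ⟨Q, mul_eq_one_comm.mp hPQ, hPQ⟩
  have hinv : ⅟P = Q := invOf_eq_right_inv hPQ
  -- The entries of `Q` sum to 2 / (p + q), so the Schur complement only shifts the constant `t`.
  have hschur : (s • (1 : Matrix m m ℝ) + Matrix.of fun _ _ ↦ t) -
      (Matrix.of fun (_ : m) (_ : Fin 2) ↦ c) * ⅟P * (Matrix.of fun (_ : Fin 2) (_ : m) ↦ c) =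
      s • (1 : Matrix m m ℝ) + Matrix.of fun _ _ ↦ (t - 2 * c ^ 2 / (p + q)) := by
    rw [hinv]
    ext i j
    simp [Q, Matrix.mul_apply, Fin.sum_univ_two]
    field_simp
    ring
  have h := Matrix.det_fromBlocks₁₁ P (Matrix.of fun (_ : Fin 2) (_ : m) ↦ c)
    (Matrix.of fun (_ : m) (_ : Fin 2) ↦ c) (s • (1 : Matrix m m ℝ) + Matrix.of fun _ _ ↦ t)
  rw [hschur, Matrix.det_scalar_add_const hs] at h
  rw [coneMatrix, h, Matrix.det_fin_two]
  simp [P]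
  left
  ring

/-- If `A w` is the constant vector `2`, the entries of `w` sum to zero, and the column of `A` at
`o` has entries `A x o`, then a border of the form `A x o + a y` can be cleared. -/
theorem det_fromBlocks_of_border {m k : Type*} [Fintype m] [DecidableEq m] [Fintype k]
    [DecidableEq k] (A : Matrix m m ℝ) (o : m) (hA : A.IsSymm) (hoo : A o o = 0) (w : m → ℝ)
    (hw : ∀ x, ∑ y, A x y * w y = 2) (hsum : ∑ y, w y = 0) (a : k → ℝ) (B : Matrix k k ℝ) :
    (Matrix.fromBlocks A (Matrix.of fun x y ↦ A x o + a y) (Matrix.of fun y x ↦ A x o + a y)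
      (Matrix.of fun y z ↦ B y z + a y + a z)).det = A.det * B.det := by
  -- Column `y` of `N` is (a y / 2) w plus the unit vector at `o`: `A` sends the first term to the
  -- constant `a y` and the second to its column at `o`.
  let N : Matrix m k ℝ := Matrix.of fun x y ↦ w x * (a y / 2) + if x = o then 1 else 0
  have hAo : ∑ x, A x o * w x = 2 := by
    rw [← hw o]
    exact Finset.sum_congr rfl fun x _ ↦ by rw [hA.apply]
  have h1 : (Matrix.of fun x y ↦ A x o + a y) = A * N := by
    ext x y
    simp only [Matrix.of_apply, Matrix.mul_apply, N, mul_add, Finset.sum_add_distrib, ← mul_assoc,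
      ← Finset.sum_mul, hw]
    simp
    ring
  have h2 : (Matrix.of fun y z ↦ B y z + a y + a z) =
      (Matrix.of fun y x ↦ A x o + a y) * N + B := by
    ext y z
    simp only [Matrix.of_apply, Matrix.add_apply, Matrix.mul_apply, N, mul_add,
      Finset.sum_add_distrib, ← mul_assoc, ← Finset.sum_mul, add_mul, hAo, ← Finset.mul_sum, hsum]
    simp [hoo]
    ring
  have h : Matrix.fromBlocks A (Matrix.of fun x y ↦ A x o + a y)
      (Matrix.of fun y x ↦ A x o + a y) (Matrix.of fun y z ↦ B y z + a y + a z) =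
      Matrix.fromBlocks A 0 (Matrix.of fun y x ↦ A x o + a y) B * Matrix.fromBlocks 1 N 0 1 := by
    rw [Matrix.fromBlocks_multiply, h2, h1]
    simp
  rw [h, Matrix.det_mul, Matrix.det_fromBlocks_zero₁₂, Matrix.det_fromBlocks_zero₂₁]
  simp

/-! ### Enumeration of the vertices and of the entries. -/

/-- The vertices of `T_n`, listed as the two base vertices followed by the non-base ones. -/
def triVert (n : ℕ) : Fin 2 ⊕ Fin (n - 2) → TVert n :=
  Sum.elim ![⟨0, (0 : Fin 1)⟩, ⟨1, (0 : Fin 1)⟩] fun j ↦ ⟨2, j⟩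

theorem triVert_injective (n : ℕ) : Function.Injective (triVert n) := by
  rintro (x | x) (y | y) h
  · have h' := congrArg Sigma.fst h
    fin_cases x <;> fin_cases y <;> simp [triVert] at h' ⊢
  · have h' := congrArg Sigma.fst h
    fin_cases x <;> simp [triVert] at h'
  · have h' := congrArg Sigma.fst h
    fin_cases y <;> simp [triVert] at h'
  · exact congrArg _ (sigma_mk_injective (β := fun i : Fin 3 ↦ Fin (![1, 1, n - 2] i)) h)

theorem triVert_surjective (n : ℕ) : Function.Surjective (triVert n) := by
  rintro ⟨i, x⟩
  fin_cases i
  · exact ⟨.inl 0, congrArg (Sigma.mk 0) (Subsingleton.elim (α := Fin 1) _ _)⟩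
  · exact ⟨.inl 1, congrArg (Sigma.mk 1) (Subsingleton.elim (α := Fin 1) _ _)⟩
  · exact ⟨.inr x, rfl⟩

theorem TGraph_dist_triVert (n : ℕ) (x y : Fin 2 ⊕ Fin (n - 2)) :
    ((TGraph n).dist (triVert n x) (triVert n y) : ℝ) =
      coneMatrix (Fin (n - 2)) 0 1 1 (-2) 2 x y := by
  rw [TGraph_dist]
  simp only [(triVert_injective n).eq_iff]
  rcases x with x | x <;> rcases y with y | y
  · fin_cases x <;> fin_cases y <;> simp [triVert, coneMatrix]
  · fin_cases x <;> simp [triVert, coneMatrix]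
  · fin_cases y <;> simp [triVert, coneMatrix]
  · by_cases h : x = y <;> simp [triVert, coneMatrix, h]

/-- The vertices of `T_6 ⊚ T_n^{(b)}` for `n = m + 3`: those of `T_6`, and in each block `T_n` the
two base vertices and the `m` non-base vertices other than the centre. -/
noncomputable def gluedVert (m b : ℕ) (hn : 3 ≤ m + 3) :
    (Fin 2 ⊕ Fin 4) ⊕ ((Fin 2 ⊕ Fin m) × Fin b) → GluedVert (blockCentre hn b) :=
  Sum.elim (fun x ↦ gluedIncl _ none (triVert 6 x))
    fun x ↦ gluedIncl _ (some x.2) (triVert (m + 3) (x.1.map id Fin.succ))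

theorem triVert_map_succ_ne_centre {m b : ℕ} (hn : 3 ≤ m + 3) (k : Fin b) (x : Fin 2 ⊕ Fin m) :
    triVert (m + 3) (x.map id Fin.succ) ≠ blockCentre hn b (some k) := by
  intro h
  have h' := triVert_injective (m + 3) (a₂ := .inr (0 : Fin (m + 1))) h
  rcases x with x | x
  · simp at h'
  · exact Fin.succ_ne_zero x (Sum.inr_injective h')

theorem gluedVert_injective (m b : ℕ) (hn : 3 ≤ m + 3) : Function.Injective (gluedVert m b hn) := by
  rintro (x | ⟨x, k⟩) (y | ⟨y, l⟩) h
  · exact congrArg _ (triVert_injective 6 (gluedIncl_injective (blockCentre hn b) none h))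
  · exact absurd (eq_root_of_gluedIncl_eq (r := blockCentre hn b) (i := none) (j := some l)
      (by simp) h) (triVert_map_succ_ne_centre hn l y)
  · exact absurd (eq_root_of_gluedIncl_eq (r := blockCentre hn b) (i := none) (j := some k)
      (by simp) h.symm) (triVert_map_succ_ne_centre hn k x)
  · by_cases hkl : k = l
    · subst hkl
      have h' := triVert_injective (m + 3) (gluedIncl_injective (blockCentre hn b) (some k) h)
      have hxy : x = y := Sum.map_injective.mpr ⟨Function.injective_id, Fin.succ_injective m⟩ h'
      rw [hxy]
    · exact absurd (eq_root_of_gluedIncl_eq (r := blockCentre hn b) (i := some k) (j := some l)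
        (by simpa using hkl) h) (triVert_map_succ_ne_centre hn l y)

theorem gluedVert_surjective (m b : ℕ) (hn : 3 ≤ m + 3) :
    Function.Surjective (gluedVert m b hn) := by
  intro z
  obtain ⟨_ | k, v, rfl⟩ := gluedIncl_surjective z
  · obtain ⟨x, rfl⟩ := triVert_surjective 6 v
    exact ⟨.inl x, rfl⟩
  · obtain ⟨x, rfl⟩ := triVert_surjective (m + 3) v
    rcases x with x | x
    · exact ⟨.inr (.inl x, k), rfl⟩
    · induction x using Fin.cases (n := m) with
      | zero =>
        refine ⟨.inl (.inr (0 : Fin 4)), ?_⟩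
        -- Index 0 is the centre, which is listed only once, among the vertices of T_6.
        exact (gluedIncl_root (r := blockCentre hn b) none).trans
          (gluedIncl_root (r := blockCentre hn b) (some k)).symm
      | succ j => exact ⟨.inr (.inr j, k), rfl⟩

/-- The entries of the distance matrix of `T_n` at the centre. -/
def centreDist (m : ℕ) : Fin 2 ⊕ Fin m → ℝ := Sum.elim (fun _ ↦ 1) fun _ ↦ 2

theorem coneMatrix_apply_centre (m : ℕ) (x : Fin 2 ⊕ Fin m) :
    coneMatrix (Fin (m + 1)) 0 1 1 (-2) 2 (x.map id Fin.succ) (.inr 0) = centreDist m x := by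
  rcases x with x | x <;> simp [coneMatrix, centreDist]

/-- The parameters are d(x, y) - d(x, o) - d(y, o), with d(·, o) equal to 1 on base and 2 on
non-base vertices. -/
theorem coneMatrix_apply_succ (m : ℕ) (x y : Fin 2 ⊕ Fin m) :
    coneMatrix (Fin (m + 1)) 0 1 1 (-2) 2 (x.map id Fin.succ) (y.map id Fin.succ) =
      coneMatrix (Fin m) (-2) (-1) (-2) (-2) (-2) x y + centreDist m x + centreDist m y := by
  rcases x with x | x <;> rcases y with y | y
  · fin_cases x <;> fin_cases y <;> norm_num [coneMatrix, centreDist]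
  · norm_num [coneMatrix, centreDist]
  · norm_num [coneMatrix, centreDist]
  · by_cases h : x = y <;> norm_num [coneMatrix, centreDist, Matrix.one_apply, h]

/-! ### The distance matrix in block form. -/

theorem T6Tn_connected {n : ℕ} (hn : 3 ≤ n) (b : ℕ) : (T6Tn hn b).Connected :=
  gluedGraph_connected fun _ ↦ TGraph_connected _

theorem T6Tn_dist_same {n : ℕ} (hn : 3 ≤ n) (b : ℕ) (i : Option (Fin b))
    (u v : TVert (blockOrder n b i)) :
    (T6Tn hn b).dist (gluedIncl _ i u) (gluedIncl _ i v) = (TGraph (blockOrder n b i)).dist u v :=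
  gluedGraph_dist_incl (fun _ ↦ TGraph_connected _) i u v

theorem T6Tn_dist_of_ne {n : ℕ} (hn : 3 ≤ n) (b : ℕ) {i j : Option (Fin b)} (hij : i ≠ j)
    (u : TVert (blockOrder n b i)) (v : TVert (blockOrder n b j)) :
    (T6Tn hn b).dist (gluedIncl _ i u) (gluedIncl _ j v) =
      (TGraph (blockOrder n b i)).dist u (blockCentre hn b i) +
        (TGraph (blockOrder n b j)).dist v (blockCentre hn b j) :=
  gluedGraph_dist_incl_of_ne (fun _ ↦ TGraph_connected _) hij u v

theorem TGraph_dist_centre_none {m b : ℕ} (hn : 3 ≤ m + 3) (x : Fin 2 ⊕ Fin 4) :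
    ((TGraph 6).dist (triVert 6 x) (blockCentre hn b none) : ℝ) =
      coneMatrix (Fin 4) 0 1 1 (-2) 2 x (.inr 0) :=
  TGraph_dist_triVert 6 x (.inr (0 : Fin 4))

theorem TGraph_dist_centre_some {m b : ℕ} (hn : 3 ≤ m + 3) (k : Fin b) (x : Fin 2 ⊕ Fin m) :
    ((TGraph (m + 3)).dist (triVert (m + 3) (x.map id Fin.succ)) (blockCentre hn b (some k)) : ℝ) =
      centreDist m x :=
  (TGraph_dist_triVert (m + 3) (x.map id Fin.succ) (.inr (0 : Fin (m + 1)))).trans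
    (coneMatrix_apply_centre m x)

theorem T6Tn_dist_inl_inl {m b : ℕ} (hn : 3 ≤ m + 3) (x y : Fin 2 ⊕ Fin 4) :
    ((T6Tn hn b).dist (gluedVert m b hn (.inl x)) (gluedVert m b hn (.inl y)) : ℝ) =
      coneMatrix (Fin 4) 0 1 1 (-2) 2 x y :=
  (congrArg (Nat.cast (R := ℝ)) (T6Tn_dist_same hn b none (triVert 6 x) (triVert 6 y))).trans
    (TGraph_dist_triVert 6 x y)

theorem T6Tn_dist_inl_inr {m b : ℕ} (hn : 3 ≤ m + 3) (x : Fin 2 ⊕ Fin 4)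
    (y : (Fin 2 ⊕ Fin m) × Fin b) :
    ((T6Tn hn b).dist (gluedVert m b hn (.inl x)) (gluedVert m b hn (.inr y)) : ℝ) =
      coneMatrix (Fin 4) 0 1 1 (-2) 2 x (.inr 0) + centreDist m y.1 := by
  have h := congrArg (Nat.cast (R := ℝ)) (T6Tn_dist_of_ne hn b (i := none) (j := some y.2) (by simp)
    (triVert 6 x) (triVert (m + 3) (y.1.map id Fin.succ)))
  rw [Nat.cast_add] at h
  exact h.trans (congrArg₂ (· + ·) (TGraph_dist_centre_none hn x)
    (TGraph_dist_centre_some hn y.2 y.1))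

theorem T6Tn_dist_inr_inr_same {m b : ℕ} (hn : 3 ≤ m + 3) (x y : Fin 2 ⊕ Fin m) (k : Fin b) :
    ((T6Tn hn b).dist (gluedVert m b hn (.inr (x, k))) (gluedVert m b hn (.inr (y, k))) : ℝ) =
      coneMatrix (Fin m) (-2) (-1) (-2) (-2) (-2) x y + centreDist m x + centreDist m y :=
  ((congrArg (Nat.cast (R := ℝ)) (T6Tn_dist_same hn b (some k) (triVert (m + 3) (x.map id Fin.succ))
    (triVert (m + 3) (y.map id Fin.succ)))).trans
    (TGraph_dist_triVert (m + 3) (x.map id Fin.succ) (y.map id Fin.succ))).trans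
    (coneMatrix_apply_succ m x y)

theorem T6Tn_dist_inr_inr_of_ne {m b : ℕ} (hn : 3 ≤ m + 3) (x y : Fin 2 ⊕ Fin m) {k l : Fin b}
    (hkl : k ≠ l) :
    ((T6Tn hn b).dist (gluedVert m b hn (.inr (x, k))) (gluedVert m b hn (.inr (y, l))) : ℝ) =
      centreDist m x + centreDist m y := by
  have h := congrArg (Nat.cast (R := ℝ)) (T6Tn_dist_of_ne hn b (i := some k) (j := some l)
    (by simpa using hkl) (triVert (m + 3) (x.map id Fin.succ))
    (triVert (m + 3) (y.map id Fin.succ)))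
  rw [Nat.cast_add] at h
  exact h.trans (congrArg₂ (· + ·) (TGraph_dist_centre_some hn k x)
    (TGraph_dist_centre_some hn l y))

theorem distMatrix_T6Tn_submatrix (m b : ℕ) (hn : 3 ≤ m + 3) :
    (distMatrix (T6Tn hn b)).submatrix (gluedVert m b hn) (gluedVert m b hn) =
      Matrix.fromBlocks (coneMatrix (Fin 4) 0 1 1 (-2) 2)
        (Matrix.of fun x y ↦ coneMatrix (Fin 4) 0 1 1 (-2) 2 x (.inr 0) + centreDist m y.1)
        (Matrix.of fun y x ↦ coneMatrix (Fin 4) 0 1 1 (-2) 2 x (.inr 0) + centreDist m y.1)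
        (Matrix.of fun y z ↦
          Matrix.blockDiagonal (fun _ : Fin b ↦ coneMatrix (Fin m) (-2) (-1) (-2) (-2) (-2)) y z +
            centreDist m y.1 + centreDist m z.1) := by
  ext (x | ⟨x, k⟩) (y | ⟨y, l⟩)
  · exact T6Tn_dist_inl_inl hn x y
  · exact T6Tn_dist_inl_inr hn x (y, l)
  · exact (congrArg (Nat.cast (R := ℝ)) SimpleGraph.dist_comm).trans
      (T6Tn_dist_inl_inr hn y (x, k))
  · by_cases hkl : k = l
    · subst hkl
      refine (T6Tn_dist_inr_inr_same hn x y k).trans ?_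
      simp [Matrix.blockDiagonal_apply]
    · refine (T6Tn_dist_inr_inr_of_ne hn x y hkl).trans ?_
      simp [Matrix.blockDiagonal_apply, hkl]

/-! ### Evaluation of the determinant. -/

theorem coneMatrix_isSymm {m : Type*} [DecidableEq m] (p q c s t : ℝ) :
    (coneMatrix m p q c s t).IsSymm := by
  ext (i | i) (j | j)
  · fin_cases i <;> fin_cases j <;> simp [coneMatrix]
  · simp [coneMatrix]
  · simp [coneMatrix]
  · simp [coneMatrix, Matrix.one_apply, eq_comm]

theorem det_coneMatrix_T6 : (coneMatrix (Fin 4) 0 1 1 (-2) 2).det = -16 := by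
  rw [det_coneMatrix] <;> norm_num

theorem det_coneMatrix_block (m : ℕ) : (coneMatrix (Fin m) (-2) (-1) (-2) (-2) (-2)).det =
    (-1) ^ (m + 3) * 2 ^ m * (m - 3) := by
  rw [det_coneMatrix _ _ (by norm_num) (by norm_num) (by norm_num), Fintype.card_fin, neg_pow]
  ring

/-- This is what singles out T_6: among the T_n, only for n = 6 does a vector of zero sum have a
nonzero constant image. -/
theorem coneMatrix_T6_mulVec (x : Fin 2 ⊕ Fin 4) :
    ∑ y, coneMatrix (Fin 4) 0 1 1 (-2) 2 x y * Sum.elim (fun _ ↦ -2) (fun _ ↦ 1) y = 2 := by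
  rcases x with x | x
  · fin_cases x <;> norm_num [coneMatrix]
  · norm_num [coneMatrix, Matrix.one_apply, Finset.sum_add_distrib]

theorem mainTheorem8 (n b : ℕ) (hn : 3 ≤ n) (hn6 : n ≠ 6) (hb : 1 ≤ b)
    {V : Type*} [Fintype V] [DecidableEq V] (G : SimpleGraph V) (hG : Nonempty (G ≃g T6Tn hn b)) :
    (distMatrix G).det =
      (-1 : ℝ) ^ (n * b + 1) * 2 ^ ((n - 3) * b + 4) * ((n : ℝ) - 6) ^ b := by
  obtain ⟨e⟩ := hG
  -- Here m counts the non-base vertices of T_n other than the centre.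
  obtain ⟨m, rfl⟩ : ∃ m, n = m + 3 := ⟨n - 3, by omega⟩
  let f := (Equiv.ofBijective _ ⟨gluedVert_injective m b hn, gluedVert_surjective m b hn⟩).trans
    e.symm.toEquiv
  have hf : (distMatrix G).submatrix f f =
      (distMatrix (T6Tn hn b)).submatrix (gluedVert m b hn) (gluedVert m b hn) := by
    ext x y
    exact congrArg Nat.cast (e.symm.dist_eq (T6Tn_connected hn b) _ _)
  rw [← Matrix.det_submatrix_equiv_self f, hf, distMatrix_T6Tn_submatrix,
    det_fromBlocks_of_border (coneMatrix (Fin 4) 0 1 1 (-2) 2) (.inr 0) (coneMatrix_isSymm ..)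
      (by simp [coneMatrix]) (Sum.elim (fun _ ↦ -2) fun _ ↦ 1) coneMatrix_T6_mulVec (by norm_num)
      (fun y : (Fin 2 ⊕ Fin m) × Fin b ↦ centreDist m y.1)
      (Matrix.blockDiagonal fun _ : Fin b ↦ coneMatrix (Fin m) (-2) (-1) (-2) (-2) (-2)),
    Matrix.det_blockDiagonal, det_coneMatrix_T6, det_coneMatrix_block, Finset.prod_const,
    Finset.card_univ, Fintype.card_fin, Nat.add_sub_cancel, Nat.cast_add, Nat.cast_ofNat,
    show (m : ℝ) + 3 - 6 = m - 3 by ring, mul_pow, mul_pow, ← pow_mul, ← pow_mul, pow_succ, pow_add]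
  ring
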